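/- For $A\subseteq\mathbb{R}^m$ and $B\subseteq\mathbb{R}^k$, a \emph{$\mathbb{Z}$-map} $A\to B$ is a function that is the restriction of a continuous function $f\colon\mathbb{R}^m\to\mathbb{R}^k$ for which there are finitely many affine maps $f_1,\dots,f_r\colon\mathbb{R}^m\to\mathbb{R}^k$ with integer coefficients (constant terms included) such that for every $x\in\mathbb{R}^m$ there is $i\le r$ with $f(x)=f_i(x)$. Let $\mathfrak{B}\subseteq\mathbb{R}^2$ be the boundary of the unit square $[0,1]^2$. A $\mathbb{Z}$-map $\sigma\colon[0,1]^p\to\mathfrak{B}$ is \emph{more general} than a $\mathbb{Z}$-map $\tau\colon[0,1]^q\to\mathfrak{B}$ if there is a $\mathbb{Z}$-map $\alpha\colon[0,1]^q\to[0,1]^p$ with $\sigma\circ\alpha=\tau$; it is \emph{strictly more general} if, moreover, $\tau$ is not more general than $\sigma$. Let $n\in\mathbb{N}$ and let $\eta\colon[0,1]^n\to\mathfrak{B}$ be a $\mathbb{Z}$-map that is not constant on $\{0,1\}^n$. Then for every $n'\in\mathbb{N}$ and every $\mathbb{Z}$-map $\theta\colon[0,1]^{n'}\to\mathfrak{B}$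 more general than $\eta$ there is a $\mathbb{Z}$-map $\psi\colon[0,1]^{\max\{2,n'\}}\to\mathfrak{B}$ that is strictly more general than $\theta$. -/

import Mathlib

/-- The unit cube `[0,1]^n` in `ℝ^n`. -/
def unitCube (n : ℕ) : Set (Fin n → ℝ) :=
  {x | ∀ i, 0 ≤ x i ∧ x i ≤ 1}

/-- The set `{0,1}^n` of vertices of the unit cube `[0,1]^n`. -/
def cubeVertices (n : ℕ) : Set (Fin n → ℝ) :=
  {x | ∀ i, x i = 0 ∨ x i = 1}

/-- The boundary `𝔅` of the unit square `[0,1]^2`: the union of its four sides. -/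
def squareBoundary : Set (Fin 2 → ℝ) :=
  convexHull ℝ {![0, 0], ![1, 0]} ∪ convexHull ℝ {![1, 0], ![1, 1]} ∪
    convexHull ℝ {![1, 1], ![0, 1]} ∪ convexHull ℝ {![0, 1], ![0, 0]}

/-- `f : ℝ^m → ℝ^n` is an affine map with integer coefficients: `f x = b + A x` with an
integer matrix `A` and an integer vector `b`. -/
def IsIntAffine {m n : ℕ} (f : (Fin m → ℝ) → (Fin n → ℝ)) : Prop :=
  ∃ (A : Fin n → Fin m → ℤ) (b : Fin n → ℤ),
    ∀ x j, f x j = (b j : ℝ) + ∑ i, (A j i : ℝ) * x i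

/-- `ℤ`-maps `ℝ^m → ℝ^n`: continuous maps that at each point agree with one of finitely many
affine maps with integer coefficients. -/
def IsGlobalZMap {m n : ℕ} (f : (Fin m → ℝ) → (Fin n → ℝ)) : Prop :=
  Continuous f ∧ ∃ (k : ℕ) (g : Fin k → (Fin m → ℝ) → (Fin n → ℝ)),
    (∀ i, IsIntAffine (g i)) ∧ ∀ x, ∃ i, f x = g i x

/-- `ℤ`-maps `A → B` between subsets `A ⊆ ℝ^m` and `B ⊆ ℝ^n`: the restrictions of `ℤ`-maps
`ℝ^m → ℝ^n`. -/
def IsZMap {m n : ℕ} {A : Set (Fin m → ℝ)} {B : Set (Fin n → ℝ)} (f : A → B) : Prop :=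
  ∃ g : (Fin m → ℝ) → (Fin n → ℝ), IsGlobalZMap g ∧ ∀ x : A, (f x : Fin n → ℝ) = g x

/-- `σ : [0,1]^p → B` is more general than `τ : [0,1]^q → B`: there is a `ℤ`-map
`α : [0,1]^q → [0,1]^p` with `σ ∘ α = τ`. -/
def MoreGeneral {d p q : ℕ} {B : Set (Fin d → ℝ)}
    (σ : unitCube p → B) (τ : unitCube q → B) : Prop :=
  ∃ α : unitCube q → unitCube p, IsZMap α ∧ σ ∘ α = τ

/-- `σ` is strictly more general than `τ`: `σ` is more general than `τ`, but not conversely. -/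
def StrictlyMoreGeneral {d p q : ℕ} {B : Set (Fin d → ℝ)}
    (σ : unitCube p → B) (τ : unitCube q → B) : Prop :=
  MoreGeneral σ τ ∧ ¬ MoreGeneral τ σ

/-!
The boundary `𝔅` of the square is a circle of length `4`, parametrized by `squareParam`. As cubes
are simply connected, every `ℤ`-map `θ` from a cube to `𝔅` unwinds to a bounded scalar `ℤ`-map `t`,
and conversely winding a bounded scalar `ℤ`-map around `𝔅` gives a `ℤ`-map (`exists_lift`,
`IsZFun.isGlobalZMap_squareParam`). If `θ ∘ β = ψ` with lifts `t` and `t'`, then `t ∘ β` and `t'`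
differ on the cube by a constant in `4ℤ`, so `t'` cannot oscillate more than `t`. It is therefore
enough to find a `ℤ`-map `α` of the cube into itself with `t ∘ α = t` whose image misses a rational
point: `t'` is obtained from `t` by adding a very high `ℤ`-bump at that point, supported off the
image of `α`, and then `t' ∘ α = t` shows that `ψ`, wound from `t'`, is more general than `θ`.

Such an `α` (`exists_push_avoiding`) exists as soon as `t` is not constant on some facet of the
cube. Near a generic rational point of the facet, `t` is a single affine function `a` that is not
constant along the facet (`exists_affine_near_facet`), so there is an integer vector `u` pointing
into the cube along which `a` is constant. Then `α x = x + φ x • u`, for a `ℤ`-function `φ ≥ 0` of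
small size and small support, preserves `t` and clears the points of the facet where `φ > 0`.

A map that is not constant on the vertices of a cube of dimension at least two is not constant on
some facet. Being more general than `η` forces `θ` to be nonconstant on vertices, because `ℤ`-maps
send vertices to vertices, and `θ` can be regarded as a map on the cube of dimension `max 2 n'`
through the coordinate projection, which has a section.
-/

/-! ### Scalar `ℤ`-maps and the cube -/

/-- The affine function `x ↦ c.2 + ∑ i, c.1 i * x i` with integer coefficients `c`. -/
def intAffine {m : ℕ} (c : (Fin m → ℤ) × ℤ) (x : Fin m → ℝ) : ℝ :=
  (c.2 : ℝ) + ∑ i, (c.1 i : ℝ) * x i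

/-- Scalar `ℤ`-maps `ℝ^m → ℝ`. The finitely many affine pieces are recorded by their integer
coefficients. -/
def IsZFun {m : ℕ} (f : (Fin m → ℝ) → ℝ) : Prop :=
  Continuous f ∧ ∃ S : Set ((Fin m → ℤ) × ℤ), S.Finite ∧ ∀ x, ∃ c ∈ S, f x = intAffine c x

theorem continuous_intAffine {m : ℕ} (c : (Fin m → ℤ) × ℤ) : Continuous (intAffine c) := by
  unfold intAffine
  fun_prop

namespace IsZFun

variable {m k : ℕ} {f g : (Fin m → ℝ) → ℝ}

theorem intAffine (c : (Fin m → ℤ) × ℤ) : IsZFun (intAffine c) :=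
  ⟨continuous_intAffine c, {c}, Set.finite_singleton c, fun _ => ⟨c, rfl, rfl⟩⟩

theorem const (b : ℤ) : IsZFun (fun _ : Fin m → ℝ => (b : ℝ)) := by
  convert IsZFun.intAffine ((0, b) : (Fin m → ℤ) × ℤ) using 2
  simp [_root_.intAffine]

theorem coord (i : Fin m) : IsZFun (fun x : Fin m → ℝ => x i) := by
  convert IsZFun.intAffine ((Pi.single i 1, 0) : (Fin m → ℤ) × ℤ) using 2
  simp [_root_.intAffine, Pi.single_apply]

/-- A continuous function that is at each point one of finitely many integer affine combinations
of `ℤ`-functions is a `ℤ`-function. All closure properties of `ℤ`-functions are instances. -/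
theorem of_pieces {G : (Fin m → ℝ) → Fin k → ℝ} (hG : ∀ j, IsZFun (fun x => G x j))
    (hf : Continuous f) {T : Set ((Fin k → ℤ) × ℤ)} (hT : T.Finite)
    (h : ∀ x, ∃ t ∈ T, f x = _root_.intAffine t (G x)) : IsZFun f := by
  choose S hS hGS using fun j => (hG j).2
  refine ⟨hf, Set.image2 (fun t (c : Fin k → (Fin m → ℤ) × ℤ) =>
    ((fun i => ∑ j, t.1 j * (c j).1 i, t.2 + ∑ j, t.1 j * (c j).2) : (Fin m → ℤ) × ℤ))
    T (Set.pi Set.univ S), hT.image2 _ (Set.Finite.pi fun j => hS j), fun x => ?_⟩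
  obtain ⟨t, ht, htx⟩ := h x
  choose c hc hcx using fun j => hGS j x
  refine ⟨_, ⟨t, ht, c, fun j _ => hc j, rfl⟩, ?_⟩
  rw [htx]
  simp only [_root_.intAffine] at hcx ⊢
  simp only [hcx, mul_add, Finset.sum_add_distrib, Finset.mul_sum, Int.cast_add, Int.cast_sum,
    Int.cast_mul, Finset.sum_mul, add_assoc]
  rw [Finset.sum_comm]
  simp only [mul_assoc]

theorem comp {f : (Fin k → ℝ) → ℝ} (hf : IsZFun f) {G : (Fin m → ℝ) → Fin k → ℝ}
    (hG : ∀ j, IsZFun (fun x => G x j)) : IsZFun (fun x => f (G x)) := by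
  obtain ⟨hc, S, hS, h⟩ := hf
  exact of_pieces hG (hc.comp (continuous_pi fun j => (hG j).1)) hS fun x => h (G x)

theorem of_pieces_one (hf : IsZFun f) (hg : Continuous g) {T : Set (ℤ × ℤ)} (hT : T.Finite)
    (h : ∀ x, ∃ t ∈ T, g x = t.1 * f x + t.2) : IsZFun g := by
  refine of_pieces (k := 1) (G := fun x _ => f x) (fun _ => hf) hg
    (hT.image fun t => ((fun _ => t.1, t.2) : (Fin 1 → ℤ) × ℤ)) fun x => ?_
  obtain ⟨t, ht, htx⟩ := h x
  exact ⟨_, ⟨t, ht, rfl⟩, by simp [_root_.intAffine, htx, add_comm]⟩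

theorem of_pieces_two {h : (Fin m → ℝ) → ℝ} (hf : IsZFun f) (hg : IsZFun g) (hh : Continuous h)
    {T : Set (ℤ × ℤ × ℤ)} (hT : T.Finite)
    (H : ∀ x, ∃ t ∈ T, h x = t.1 * f x + t.2.1 * g x + t.2.2) : IsZFun h := by
  refine of_pieces (k := 2) (G := fun x => ![f x, g x]) (fun j => ?_) hh
    (hT.image fun t => ((![t.1, t.2.1], t.2.2) : (Fin 2 → ℤ) × ℤ)) fun x => ?_
  · fin_cases j
    · exact hf
    · exact hg
  · obtain ⟨t, ht, htx⟩ := H x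
    exact ⟨_, ⟨t, ht, rfl⟩, by simp [_root_.intAffine, htx, add_comm]⟩

theorem add (hf : IsZFun f) (hg : IsZFun g) : IsZFun (fun x => f x + g x) :=
  of_pieces_two hf hg (hf.1.add hg.1) (Set.finite_singleton (1, 1, 0)) fun x => by simp

theorem sub (hf : IsZFun f) (hg : IsZFun g) : IsZFun (fun x => f x - g x) :=
  of_pieces_two hf hg (hf.1.sub hg.1) (Set.finite_singleton (1, -1, 0)) fun x => by
    simp [sub_eq_add_neg]

theorem int_mul (b : ℤ) (hf : IsZFun f) : IsZFun (fun x => b * f x) :=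
  of_pieces_one hf (hf.1.const_mul _) (Set.finite_singleton (b, 0)) fun x => by simp

theorem max (hf : IsZFun f) (hg : IsZFun g) : IsZFun (fun x => Max.max (f x) (g x)) :=
  of_pieces_two hf hg (hf.1.max hg.1) (Set.toFinite {(1, 0, 0), (0, 1, 0)}) fun x => by
    rcases max_choice (f x) (g x) with h | h <;> simp [h]

theorem min (hf : IsZFun f) (hg : IsZFun g) : IsZFun (fun x => Min.min (f x) (g x)) :=
  of_pieces_two hf hg (hf.1.min hg.1) (Set.toFinite {(1, 0, 0), (0, 1, 0)}) fun x => by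
    rcases min_choice (f x) (g x) with h | h <;> simp [h]

theorem abs (hf : IsZFun f) : IsZFun (fun x => |f x|) :=
  of_pieces_one hf hf.1.abs (Set.toFinite {(1, 0), (-1, 0)}) fun x => by
    rcases abs_choice (f x) with h | h <;> simp [h]

theorem sum {G : (Fin m → ℝ) → Fin k → ℝ} (hG : ∀ j, IsZFun (fun x => G x j)) :
    IsZFun (fun x => ∑ j, G x j) :=
  of_pieces hG (continuous_finsetSum _ fun j _ => (hG j).1)
    (Set.finite_singleton (fun _ => 1, 0)) fun x => by simp [_root_.intAffine]

end IsZFun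

/-- A map into `ℝ^n` is a `ℤ`-map exactly when its coordinates are `ℤ`-functions. -/
theorem isGlobalZMap_iff {m n : ℕ} {f : (Fin m → ℝ) → (Fin n → ℝ)} :
    IsGlobalZMap f ↔ ∀ j, IsZFun (fun x => f x j) := by
  constructor
  · rintro ⟨hc, k, g, hg, h⟩ j
    choose A b hAb using hg
    refine ⟨(continuous_apply j).comp hc, Set.range fun i => (A i j, b i j),
      Set.finite_range _, fun x => ?_⟩
    obtain ⟨i, hi⟩ := h x
    exact ⟨_, ⟨i, rfl⟩, by simp only [hi, hAb, intAffine]⟩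
  · intro hf
    choose S hS h using fun j => (hf j).2
    have : Finite (Set.pi Set.univ S) := (Set.Finite.pi fun j => hS j).to_subtype
    obtain ⟨k, ⟨e⟩⟩ := Finite.exists_equiv_fin (Set.pi Set.univ S)
    refine ⟨continuous_pi fun j => (hf j).1, k,
      fun i x j => intAffine ((e.symm i : Fin n → (Fin m → ℤ) × ℤ) j) x, fun i => ?_, fun x => ?_⟩
    · exact ⟨fun j => ((e.symm i : Fin n → (Fin m → ℤ) × ℤ) j).1,
        fun j => ((e.symm i : Fin n → (Fin m → ℤ) × ℤ) j).2, fun x j => rfl⟩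
    · choose c hc hcx using fun j => h j x
      exact ⟨e ⟨c, fun j _ => hc j⟩, by ext j; simp [hcx]⟩

/-- The coordinatewise retraction of `ℝ^m` onto the unit cube. -/
def cubeRetract {m : ℕ} (x : Fin m → ℝ) : Fin m → ℝ := fun i => max 0 (min 1 (x i))

theorem cubeRetract_mem {m : ℕ} (x : Fin m → ℝ) : cubeRetract x ∈ unitCube m := fun _ =>
  ⟨le_max_left _ _, max_le zero_le_one (min_le_left _ _)⟩

theorem cubeRetract_of_mem {m : ℕ} {x : Fin m → ℝ} (hx : x ∈ unitCube m) : cubeRetract x = x := by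
  ext i
  simp [cubeRetract, (hx i).1, (hx i).2]

theorem IsZFun.cubeRetract {m : ℕ} (i : Fin m) :
    IsZFun (fun x : Fin m → ℝ => cubeRetract x i) := by
  simpa [_root_.cubeRetract] using (IsZFun.const 0).max ((IsZFun.const 1).min (IsZFun.coord i))

theorem continuous_cubeRetract {m : ℕ} : Continuous (cubeRetract : (Fin m → ℝ) → Fin m → ℝ) :=
  continuous_pi fun i => (IsZFun.cubeRetract i).1

theorem unitCube_eq_pi (m : ℕ) : unitCube m = Set.pi Set.univ fun _ => Set.Icc (0 : ℝ) 1 := by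
  ext x
  simp only [unitCube, Set.mem_ofPred_eq, Set.mem_pi, Set.mem_univ, true_imp_iff, Set.mem_Icc]

theorem isCompact_unitCube (m : ℕ) : IsCompact (unitCube m) := by
  rw [unitCube_eq_pi]
  exact isCompact_univ_pi fun _ => isCompact_Icc

theorem convex_unitCube (m : ℕ) : Convex ℝ (unitCube m) := by
  rw [unitCube_eq_pi]
  exact convex_pi fun _ _ => convex_Icc _ _

theorem cubeVertices_subset (m : ℕ) : cubeVertices m ⊆ unitCube m := fun x hx i => by
  rcases hx i with h | h <;> simp [h]

/-- A `ℤ`-map takes integer values at integer points, so it sends vertices to vertices. -/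
theorem IsZMap.map_cubeVertices {m n : ℕ} {α : unitCube m → unitCube n} (hα : IsZMap α)
    {x : unitCube m} (hx : (x : Fin m → ℝ) ∈ cubeVertices m) :
    (α x : Fin n → ℝ) ∈ cubeVertices n := by
  intro j
  obtain ⟨g, hg, h⟩ := hα
  obtain ⟨-, S, -, hS⟩ := isGlobalZMap_iff.1 hg j
  obtain ⟨c, -, hc⟩ := hS x
  replace hc : g x j = intAffine c x := hc
  choose v hv using fun i => show ∃ v : ℤ, (x : Fin m → ℝ) i = v from by
    rcases hx i with h | h
    · exact ⟨0, by simp [h]⟩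
    · exact ⟨1, by simp [h]⟩
  have hval : (α x : Fin n → ℝ) j = ((c.2 + ∑ i, c.1 i * v i : ℤ) : ℝ) := by
    rw [h x]
    rw [hc]
    simp [intAffine, hv]
  have h0 := ((α x).2 j).1
  have h1 := ((α x).2 j).2
  rw [hval] at h0 h1 ⊢
  norm_cast at h0 h1 ⊢
  omega

/-! ### Unwinding the boundary of the square -/

instance fact_zero_lt_four : Fact ((0 : ℝ) < 4) := ⟨by norm_num⟩

/-- The perimeter parametrization `ℝ / 4ℤ → 𝔅` of the boundary of the unit square, starting at
the origin and running counterclockwise. Each coordinate is a truncated distance to the midpoint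
of the side on which it vanishes, which makes continuity evident. -/
noncomputable def squareParam (z : AddCircle (4 : ℝ)) : Fin 2 → ℝ :=
  ![max 0 (min 1 (‖z - ((7 / 2 : ℝ) : AddCircle (4 : ℝ))‖ - 1 / 2)),
    max 0 (min 1 (‖z - ((1 / 2 : ℝ) : AddCircle (4 : ℝ))‖ - 1 / 2))]

theorem continuous_squareParam : Continuous squareParam := by
  refine continuous_pi fun j => ?_
  fin_cases j <;> simp [squareParam] <;> fun_prop

theorem AddCircle.coe_add_int_mul_period {p : ℝ} (t : ℝ) (k : ℤ) :
    ((t + p * k : ℝ) : AddCircle p) = t := by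
  rw [AddCircle.coe_add, mul_comm, ← zsmul_eq_mul, AddCircle.coe_zsmul, AddCircle.coe_period]
  simp

theorem norm_coe_sub_coe (t u : ℝ) (k : ℤ) (h : |t - u - 4 * k| ≤ 2) :
    ‖(t : AddCircle (4 : ℝ)) - (u : AddCircle (4 : ℝ))‖ = |t - u - 4 * k| := by
  rw [← (AddCircle.norm_coe_eq_abs_iff (4 : ℝ) (by norm_num)).2 (h.trans (by norm_num)),
    ← AddCircle.coe_sub]
  congr 1
  have := AddCircle.coe_add_int_mul_period (p := 4) (t - u) (-k)
  rw [← this]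
  congr 1
  push_cast
  ring

theorem squareParam_of_le_one {s : ℝ} (h0 : 0 ≤ s) (h1 : s ≤ 1) :
    squareParam (s : ℝ) = ![s, 0] := by
  rw [squareParam, norm_coe_sub_coe s _ (-1) (by rw [abs_le]; push_cast; constructor <;> linarith),
    norm_coe_sub_coe s _ 0 (by rw [abs_le]; push_cast; constructor <;> linarith),
    abs_of_nonneg (a := s - 7 / 2 - _) (by push_cast; linarith)]
  congr 1
  · rw [min_eq_right (by push_cast; linarith), max_eq_right (by push_cast; linarith)]
    push_cast
    ring
  · congr 1
    refine max_eq_left ((min_le_right _ _).trans ?_)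
    rw [sub_nonpos, abs_le]
    push_cast
    constructor <;> linarith

theorem squareParam_of_le_two {s : ℝ} (h0 : 1 ≤ s) (h1 : s ≤ 2) :
    squareParam (s : ℝ) = ![1, s - 1] := by
  have hx : (1 : ℝ) ≤ ‖(s : AddCircle (4 : ℝ)) - ((7 / 2 : ℝ) : AddCircle (4 : ℝ))‖ - 1 / 2 := by
    rcases le_total s (3 / 2) with h | h
    · rw [norm_coe_sub_coe s _ (-1) (by rw [abs_le]; push_cast; constructor <;> linarith),
        abs_of_nonneg (by push_cast; linarith)]
      push_cast
      linarith
    · rw [norm_coe_sub_coe s _ 0 (by rw [abs_le]; push_cast; constructor <;> linarith),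
        abs_of_nonpos (by push_cast; linarith)]
      push_cast
      linarith
  rw [squareParam, min_eq_left hx, max_eq_right zero_le_one,
    norm_coe_sub_coe s _ 0 (by rw [abs_le]; push_cast; constructor <;> linarith),
    abs_of_nonneg (by push_cast; linarith)]
  congr 2
  rw [min_eq_right (by push_cast; linarith), max_eq_right (by push_cast; linarith)]
  push_cast
  ring

theorem squareParam_of_le_three {s : ℝ} (h0 : 2 ≤ s) (h1 : s ≤ 3) :
    squareParam (s : ℝ) = ![3 - s, 1] := by
  have hy : (1 : ℝ) ≤ ‖(s : AddCircle (4 : ℝ)) - ((1 / 2 : ℝ) : AddCircle (4 : ℝ))‖ - 1 / 2 := by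
    rcases le_total s (5 / 2) with h | h
    · rw [norm_coe_sub_coe s _ 0 (by rw [abs_le]; push_cast; constructor <;> linarith),
        abs_of_nonneg (by push_cast; linarith)]
      push_cast
      linarith
    · rw [norm_coe_sub_coe s _ 1 (by rw [abs_le]; push_cast; constructor <;> linarith),
        abs_of_nonpos (by push_cast; linarith)]
      push_cast
      linarith
  rw [squareParam, min_eq_left hy, max_eq_right zero_le_one,
    norm_coe_sub_coe s _ 0 (by rw [abs_le]; push_cast; constructor <;> linarith),
    abs_of_nonpos (by push_cast; linarith)]
  congr 1
  rw [min_eq_right (by push_cast; linarith), max_eq_right (by push_cast; linarith)]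
  push_cast
  ring

theorem squareParam_of_le_four {s : ℝ} (h0 : 3 ≤ s) (h1 : s ≤ 4) :
    squareParam (s : ℝ) = ![0, 4 - s] := by
  rw [squareParam, norm_coe_sub_coe s _ 0 (by rw [abs_le]; push_cast; constructor <;> linarith),
    norm_coe_sub_coe s _ 1 (by rw [abs_le]; push_cast; constructor <;> linarith),
    abs_of_nonpos (a := s - 1 / 2 - _) (by push_cast; linarith)]
  congr 1
  · refine max_eq_left ((min_le_right _ _).trans ?_)
    rw [sub_nonpos, abs_le]
    push_cast
    constructor <;> linarith
  · congr 1
    rw [min_eq_right (by push_cast; linarith), max_eq_right (by push_cast; linarith)]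
    push_cast
    ring

/-- The four sides: every real parameter is congruent modulo `4` to one in `[0,4]`, and on each
side the parametrization is affine. -/
theorem squareParam_cases (t : ℝ) : ∃ (k : ℤ) (s : ℝ), t = s + 4 * k ∧ 0 ≤ s ∧ s ≤ 4 ∧
    ((0 ≤ s ∧ s ≤ 1 ∧ squareParam (t : ℝ) = ![s, 0]) ∨
      (1 ≤ s ∧ s ≤ 2 ∧ squareParam (t : ℝ) = ![1, s - 1]) ∨
      (2 ≤ s ∧ s ≤ 3 ∧ squareParam (t : ℝ) = ![3 - s, 1]) ∨
      (3 ≤ s ∧ s ≤ 4 ∧ squareParam (t : ℝ) = ![0, 4 - s])) := by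
  have h0 := Int.floor_le (t / 4)
  have h1 := Int.lt_floor_add_one (t / 4)
  set k := ⌊t / 4⌋
  obtain ⟨s, hs⟩ : ∃ s, s = t - 4 * k := ⟨_, rfl⟩
  have ht : t = s + 4 * k := by linarith
  have hst : squareParam (t : ℝ) = squareParam (s : ℝ) := by
    rw [ht, AddCircle.coe_add_int_mul_period]
  have hs0 : 0 ≤ s := by linarith
  have hs4 : s ≤ 4 := by linarith
  refine ⟨k, s, ht, hs0, hs4, ?_⟩
  rw [hst]
  rcases le_total s 1 with h | h
  · exact Or.inl ⟨hs0, h, squareParam_of_le_one hs0 h⟩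
  rcases le_total s 2 with h' | h'
  · exact Or.inr (Or.inl ⟨h, h', squareParam_of_le_two h h'⟩)
  rcases le_total s 3 with h'' | h''
  · exact Or.inr (Or.inr (Or.inl ⟨h', h'', squareParam_of_le_three h' h''⟩))
  · exact Or.inr (Or.inr (Or.inr ⟨h'', hs4, squareParam_of_le_four h'' hs4⟩))

/-- A bounded parameter has made a bounded number of turns. -/
theorem turns_bound {t s : ℝ} {k : ℤ} {B : ℕ} (ht : t = s + 4 * k) (hs0 : 0 ≤ s) (hs4 : s ≤ 4)
    (hB : |t| < B) : -(4 + (B : ℤ)) < 4 * k ∧ 4 * k < 4 + (B : ℤ) := by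
  obtain ⟨h0, h1⟩ := abs_lt.1 hB
  constructor
  · have : -(4 + (B : ℝ)) < 4 * k := by linarith
    exact_mod_cast this
  · have : 4 * (k : ℝ) < 4 + B := by linarith
    exact_mod_cast this

theorem mem_squareBoundary_iff {x : Fin 2 → ℝ} : x ∈ squareBoundary ↔
    (0 ≤ x 0 ∧ x 0 ≤ 1 ∧ x 1 = 0) ∨ (x 0 = 1 ∧ 0 ≤ x 1 ∧ x 1 ≤ 1) ∨
      (0 ≤ x 0 ∧ x 0 ≤ 1 ∧ x 1 = 1) ∨ (x 0 = 0 ∧ 0 ≤ x 1 ∧ x 1 ≤ 1) := by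
  have hx : x = ![x 0, x 1] := by ext j; fin_cases j <;> rfl
  simp only [squareBoundary, Set.mem_union, convexHull_pair, segment_eq_image, or_assoc]
  refine or_congr ?_ (or_congr ?_ (or_congr ?_ ?_))
  · constructor
    · rintro ⟨t, ⟨h0, h1⟩, rfl⟩
      simp [h0, h1]
    · rintro ⟨h0, h1, h⟩
      exact ⟨x 0, ⟨h0, h1⟩, by ext j; fin_cases j <;> simp [h]⟩
  · constructor
    · rintro ⟨t, ⟨h0, h1⟩, rfl⟩
      simp [h0, h1]
    · rintro ⟨h, h0, h1⟩
      exact ⟨x 1, ⟨h0, h1⟩, by ext j; fin_cases j <;> simp [h]⟩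
  · constructor
    · rintro ⟨t, ⟨h0, h1⟩, rfl⟩
      simp [h0, h1]
    · rintro ⟨h0, h1, h⟩
      exact ⟨1 - x 0, ⟨by linarith, by linarith⟩, by ext j; fin_cases j <;> simp [h]⟩
  · constructor
    · rintro ⟨t, ⟨h0, h1⟩, rfl⟩
      simp [h0, h1]
    · rintro ⟨h, h0, h1⟩
      exact ⟨1 - x 1, ⟨by linarith, by linarith⟩, by ext j; fin_cases j <;> simp [h]⟩

theorem squareParam_mem (z : AddCircle (4 : ℝ)) : squareParam z ∈ squareBoundary := by
  induction z using QuotientAddGroup.induction_on with | _ t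
  obtain ⟨k, s, -, -, -, h⟩ := squareParam_cases t
  rw [mem_squareBoundary_iff]
  rcases h with ⟨h0, h1, h⟩ | ⟨h0, h1, h⟩ | ⟨h0, h1, h⟩ | ⟨h0, h1, h⟩ <;> rw [h] <;>
    simp only [Matrix.cons_val_zero, Matrix.cons_val_one]
  · exact Or.inl ⟨h0, h1, trivial⟩
  · exact Or.inr (Or.inl ⟨trivial, by linarith, by linarith⟩)
  · exact Or.inr (Or.inr (Or.inl ⟨by linarith, by linarith, trivial⟩))
  · exact Or.inr (Or.inr (Or.inr ⟨trivial, by linarith, by linarith⟩))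

theorem exists_squareParam_eq {x : Fin 2 → ℝ} (hx : x ∈ squareBoundary) :
    ∃ z, squareParam z = x := by
  have hx' : x = ![x 0, x 1] := by ext j; fin_cases j <;> rfl
  rcases mem_squareBoundary_iff.1 hx with ⟨h0, h1, h⟩ | ⟨h, h0, h1⟩ | ⟨h0, h1, h⟩ | ⟨h, h0, h1⟩
  · exact ⟨(x 0 : ℝ), by rw [squareParam_of_le_one h0 h1]; rw [hx', h]; simp⟩
  · exact ⟨(1 + x 1 : ℝ), by
      rw [squareParam_of_le_two (by linarith) (by linarith)]; rw [hx', h]; simp⟩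
  · exact ⟨(3 - x 0 : ℝ), by
      rw [squareParam_of_le_three (by linarith) (by linarith)]; rw [hx', h]; simp⟩
  · exact ⟨(4 - x 1 : ℝ), by
      rw [squareParam_of_le_four (by linarith) (by linarith)]; rw [hx', h]; simp⟩

/-- Two real parameters of the same boundary point differ by a whole number of turns. -/
theorem exists_sub_eq_of_squareParam_eq {t u : ℝ}
    (h : squareParam (t : ℝ) = squareParam (u : ℝ)) : ∃ k : ℤ, t - u = 4 * k := by
  obtain ⟨k, s, ht, -, -, hs⟩ := squareParam_cases t
  obtain ⟨l, r, hu, -, -, hr⟩ := squareParam_cases u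
  have key : s - r = 0 ∨ s - r = 4 ∨ s - r = -4 := by
    have e0 := congrFun h 0
    have e1 := congrFun h 1
    rcases hs with ⟨h0, h1, hs⟩ | ⟨h0, h1, hs⟩ | ⟨h0, h1, hs⟩ | ⟨h0, h1, hs⟩ <;>
    rcases hr with ⟨h2, h3, hr⟩ | ⟨h2, h3, hr⟩ | ⟨h2, h3, hr⟩ | ⟨h2, h3, hr⟩ <;>
    simp only [hs, hr, Matrix.cons_val_zero, Matrix.cons_val_one] at e0 e1 <;>
    first
      | (left; linarith)
      | (right; left; linarith)
      | (right; right; linarith)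
  rcases key with h | h | h
  · exact ⟨k - l, by push_cast; linarith⟩
  · exact ⟨k - l + 1, by push_cast; linarith⟩
  · exact ⟨k - l - 1, by push_cast; linarith⟩

theorem squareParam_injective : Function.Injective squareParam := by
  intro z w h
  induction z using QuotientAddGroup.induction_on with | _ t
  induction w using QuotientAddGroup.induction_on with | _ u
  obtain ⟨k, hk⟩ := exists_sub_eq_of_squareParam_eq h
  have : t = u + 4 * k := by linarith
  rw [this]
  exact AddCircle.coe_add_int_mul_period u k

/-- The boundary of the unit square is a circle of length `4`. -/
noncomputable def squareHomeo : AddCircle (4 : ℝ) ≃ₜ squareBoundary :=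
  Continuous.homeoOfEquivCompactToT2
    (f := Equiv.ofBijective (fun z => ⟨squareParam z, squareParam_mem z⟩)
      ⟨fun _ _ h => squareParam_injective (congrArg Subtype.val h), fun x => by
        obtain ⟨z, hz⟩ := exists_squareParam_eq x.2
        exact ⟨z, Subtype.ext hz⟩⟩)
    (continuous_squareParam.subtype_mk _)

theorem squareHomeo_apply (z : AddCircle (4 : ℝ)) :
    (squareHomeo z : Fin 2 → ℝ) = squareParam z := rfl

/-- Winding a bounded `ℤ`-function around the boundary of the square gives a `ℤ`-map. Boundedness
limits the number of turns, hence of affine pieces. -/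
theorem IsZFun.isGlobalZMap_squareParam {m : ℕ} {f : (Fin m → ℝ) → ℝ} (hf : IsZFun f) {M : ℝ}
    (hM : ∀ x, |f x| ≤ M) : IsGlobalZMap (fun x => squareParam (f x : ℝ)) := by
  have hcont : Continuous (fun x => squareParam (f x : ℝ)) :=
    continuous_squareParam.comp ((AddCircle.continuous_mk' 4).comp hf.1)
  obtain ⟨B, hB⟩ := exists_nat_gt M
  refine isGlobalZMap_iff.2 fun j => ?_
  -- The pieces have slope `0` or `±1` and a constant term controlled by the number of turns.
  refine hf.of_pieces_one ((continuous_apply j).comp hcont)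
    (T := Set.Icc (-1, -(10 + 4 * B)) (1, 10 + 4 * B)) (Set.finite_Icc _ _)
    fun x => ?_
  obtain ⟨k, s, ht, hs0, hs4, h⟩ := squareParam_cases (f x)
  obtain ⟨k0, k1⟩ := turns_bound ht hs0 hs4 ((hM x).trans_lt hB)
  have hmem : ∀ e d : ℤ, -1 ≤ e → e ≤ 1 → -(10 + 4 * (B : ℤ)) ≤ d →
      d ≤ 10 + 4 * (B : ℤ) → (e, d) ∈ Set.Icc ((-1, -(10 + 4 * B)) : ℤ × ℤ)
        (1, 10 + 4 * B) := fun e d h1 h2 h3 h4 => ⟨⟨h1, h3⟩, ⟨h2, h4⟩⟩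
  have hs' : s = f x - 4 * k := by linarith
  rcases h with ⟨h0, h1, h⟩ | ⟨h0, h1, h⟩ | ⟨h0, h1, h⟩ | ⟨h0, h1, h⟩ <;>
    simp only [h] <;> fin_cases j
  · exact ⟨(1, -(4 * k)), hmem _ _ (by omega) (by omega) (by omega) (by omega), by simp [hs']; ring⟩
  · exact ⟨(0, 0), hmem _ _ (by omega) (by omega) (by omega) (by omega), by simp⟩
  · exact ⟨(0, 1), hmem _ _ (by omega) (by omega) (by omega) (by omega), by simp⟩
  · exact ⟨(1, -(4 * k) - 1), hmem _ _ (by omega) (by omega) (by omega) (by omega), by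
      simp [hs']; ring⟩
  · exact ⟨(-1, 4 * k + 3), hmem _ _ (by omega) (by omega) (by omega) (by omega), by
      simp [hs']; ring⟩
  · exact ⟨(0, 1), hmem _ _ (by omega) (by omega) (by omega) (by omega), by simp⟩
  · exact ⟨(0, 0), hmem _ _ (by omega) (by omega) (by omega) (by omega), by simp⟩
  · exact ⟨(-1, 4 * k + 4), hmem _ _ (by omega) (by omega) (by omega) (by omega), by
      simp [hs']; ring⟩

/-- Every `ℤ`-map from a cube to the boundary of the square unwinds to a bounded `ℤ`-function:
a continuous lift exists because `ℝ^m` is simply connected, and it is piecewise integer affine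
because each side of the square is traversed at unit speed. -/
theorem exists_lift {m : ℕ} {θ : unitCube m → squareBoundary} (hθ : IsZMap θ) :
    ∃ t : (Fin m → ℝ) → ℝ, IsZFun t ∧ (∃ M, ∀ x, |t x| ≤ M) ∧
      ∀ x : unitCube m, (θ x : Fin 2 → ℝ) = squareParam (t x : ℝ) := by
  obtain ⟨g, hg, hθg⟩ := hθ
  have hret (x : Fin m → ℝ) : (θ ⟨cubeRetract x, cubeRetract_mem x⟩ : Fin 2 → ℝ) =
      g (cubeRetract x) := hθg _
  have hmem (x : Fin m → ℝ) : g (cubeRetract x) ∈ squareBoundary := hret x ▸ Subtype.coe_prop _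
  let F : C(Fin m → ℝ, AddCircle (4 : ℝ)) :=
    ⟨fun x => squareHomeo.symm ⟨g (cubeRetract x), hmem x⟩,
      squareHomeo.symm.continuous.comp ((hg.1.comp continuous_cubeRetract).subtype_mk _)⟩
  obtain ⟨e₀, he₀⟩ := QuotientAddGroup.mk_surjective (F 0)
  obtain ⟨T, ⟨-, hT⟩, -⟩ := (AddCircle.isCoveringMap_coe (4 : ℝ)).existsUnique_continuousMap_lifts
    F 0 e₀ he₀
  have hTg (x : Fin m → ℝ) : squareParam (T x : ℝ) = g (cubeRetract x) := by
    have : ((T x : ℝ) : AddCircle (4 : ℝ)) = F x := congrFun hT x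
    rw [this, ← squareHomeo_apply]
    simp [F]
  obtain ⟨M, hM⟩ := (isCompact_unitCube m).exists_bound_of_continuousOn T.continuous.continuousOn
  have hidem (x : Fin m → ℝ) : cubeRetract (cubeRetract x) = cubeRetract x :=
    cubeRetract_of_mem (cubeRetract_mem x)
  have htg (x : Fin m → ℝ) : squareParam (T (cubeRetract x) : ℝ) = g (cubeRetract x) := by
    rw [hTg, hidem]
  have hbd (x : Fin m → ℝ) : |T (cubeRetract x)| ≤ M := hM _ (cubeRetract_mem x)
  have hG (j : Fin 2) : IsZFun (fun x => g (cubeRetract x) j) :=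
    (isGlobalZMap_iff.1 hg j).comp IsZFun.cubeRetract
  refine ⟨fun x => T (cubeRetract x), ?_, ⟨M, hbd⟩, fun x => ?_⟩
  · obtain ⟨B, hB⟩ := exists_nat_gt M
    -- On each side the parameter is `±` one of the coordinates, up to a bounded integer.
    refine IsZFun.of_pieces_two (hG 0) (hG 1) (T.continuous.comp continuous_cubeRetract)
      (T := Set.Icc (-1, -1, -(10 + 4 * B)) (1, 1, 10 + 4 * B))
      (Set.finite_Icc _ _) fun x => ?_
    obtain ⟨k, s, ht, hs0, hs4, h⟩ := squareParam_cases (T (cubeRetract x))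
    obtain ⟨k0, k1⟩ := turns_bound ht hs0 hs4 ((hbd x).trans_lt hB)
    have hmem : ∀ e e' d : ℤ, -1 ≤ e → e ≤ 1 → -1 ≤ e' → e' ≤ 1 →
        -(10 + 4 * (B : ℤ)) ≤ d → d ≤ 10 + 4 * (B : ℤ) →
        (e, e', d) ∈ Set.Icc ((-1, -1, -(10 + 4 * B)) : ℤ × ℤ × ℤ)
          (1, 1, 10 + 4 * B) :=
      fun e e' d h1 h2 h3 h4 h5 h6 => ⟨⟨h1, h3, h5⟩, ⟨h2, h4, h6⟩⟩
    rw [htg] at h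
    rcases h with ⟨h0, h1, h⟩ | ⟨h0, h1, h⟩ | ⟨h0, h1, h⟩ | ⟨h0, h1, h⟩
    · exact ⟨(1, 0, 4 * k), hmem _ _ _ (by omega) (by omega) (by omega) (by omega) (by omega)
        (by omega), by simp [h, ht]⟩
    · exact ⟨(0, 1, 4 * k + 1), hmem _ _ _ (by omega) (by omega) (by omega) (by omega) (by omega)
        (by omega), by simp [h, ht]⟩
    · exact ⟨(-1, 0, 4 * k + 3), hmem _ _ _ (by omega) (by omega) (by omega) (by omega) (by omega)
        (by omega), by simp [h, ht]⟩
    · exact ⟨(0, -1, 4 * k + 4), hmem _ _ _ (by omega) (by omega) (by omega) (by omega) (by omega)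
        (by omega), by simp [h, ht]⟩
  · have := htg x
    rw [cubeRetract_of_mem x.2] at this
    simp only [cubeRetract_of_mem x.2, this, hθg]

/-! ### Bump functions and affine behaviour near a facet -/

/-- The `ℤ`-function with a peak of height `1` at the rational point `P / q`, vanishing outside a
neighbourhood of that point that shrinks as `K` grows. -/
def bump {m : ℕ} (K q : ℕ) (P : Fin m → ℤ) (x : Fin m → ℝ) : ℝ :=
  max 0 (1 - K * ∑ i, |q * x i - P i|)

theorem isZFun_bump {m : ℕ} (K q : ℕ) (P : Fin m → ℤ) : IsZFun (bump K q P) := by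
  have h (i : Fin m) : IsZFun (fun x : Fin m → ℝ => |(q : ℝ) * x i - P i|) := by
    simpa using (((IsZFun.coord i).int_mul (q : ℤ)).sub (IsZFun.const (P i))).abs
  change IsZFun fun x => max 0 (1 - K * ∑ i, |q * x i - P i|)
  simpa using (IsZFun.const 0).max
    ((IsZFun.const 1).sub ((IsZFun.sum (G := fun x i => |(q : ℝ) * x i - P i|) h).int_mul (K : ℤ)))

theorem bump_nonneg {m : ℕ} (K q : ℕ) (P : Fin m → ℤ) (x : Fin m → ℝ) : 0 ≤ bump K q P x :=
  le_max_left _ _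

theorem bump_center {m : ℕ} (K : ℕ) {q : ℕ} (hq : 0 < q) (P : Fin m → ℤ) :
    bump K q P (fun i => (P i : ℝ) / q) = 1 := by
  have hq' : (q : ℝ) ≠ 0 := by positivity
  simp [bump, mul_div_cancel₀ _ hq']

theorem mul_abs_lt_one_of_bump_pos {m K q : ℕ} {P : Fin m → ℤ} {x : Fin m → ℝ}
    (h : 0 < bump K q P x) (i : Fin m) : K * |q * x i - P i| < 1 := by
  have h1 : K * ∑ i, |q * x i - P i| < 1 := by
    rcases lt_max_iff.1 h with h | h
    · exact absurd h (lt_irrefl _)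
    · linarith
  refine lt_of_le_of_lt ?_ h1
  exact mul_le_mul_of_nonneg_left (Finset.single_le_sum (f := fun i => |(q : ℝ) * x i - P i|)
    (fun i _ => abs_nonneg _) (Finset.mem_univ i)) (Nat.cast_nonneg K)

theorem abs_sub_div_le {q : ℕ} (hq : 0 < q) (x : ℝ) (P : ℤ) : |x - P / q| ≤ |q * x - P| := by
  have hq1 : (1 : ℝ) ≤ q := by exact_mod_cast hq
  have : q * x - P = q * (x - P / q) := by field_simp
  rw [this, abs_mul, abs_of_pos (zero_lt_one.trans_le hq1)]
  exact le_mul_of_one_le_left (abs_nonneg _) hq1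

theorem exists_bump_eq_zero {m q : ℕ} (hq : 0 < q) {P : Fin m → ℤ} {C : Set (Fin m → ℝ)}
    (hC : IsClosed C) (hP : (fun i => (P i : ℝ) / q) ∉ C) :
    ∃ K : ℕ, ∀ x ∈ C, bump K q P x = 0 := by
  obtain ⟨δ, hδ, h⟩ := Metric.isOpen_iff.1 hC.isOpen_compl _ hP
  obtain ⟨K, hK⟩ := exists_nat_gt (1 / δ)
  refine ⟨K, fun x hx => ?_⟩
  by_contra hne
  have hpos := lt_of_le_of_ne (bump_nonneg K q P x) (Ne.symm hne)
  refine h (a := x) ?_ hx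
  rw [Metric.mem_ball, dist_pi_lt_iff hδ]
  intro i
  have h1 := mul_abs_lt_one_of_bump_pos hpos i
  have hK' : 1 < K * δ := by rwa [div_lt_iff₀ hδ] at hK
  rw [Real.dist_eq]
  have hK0 : (0 : ℝ) < K := lt_trans (by positivity) hK
  have h2 : (K : ℝ) * |x i - P i / q| < K * δ := by
    refine lt_of_le_of_lt ?_ (h1.trans hK')
    exact mul_le_mul_of_nonneg_left (abs_sub_div_le hq _ _) hK0.le
  exact lt_of_mul_lt_mul_left h2 hK0.le

theorem intAffine_sub {m : ℕ} (c d : (Fin m → ℤ) × ℤ) (x : Fin m → ℝ) :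
    intAffine (c - d) x = intAffine c x - intAffine d x := by
  simp only [intAffine, Prod.fst_sub, Prod.snd_sub, Pi.sub_apply, Int.cast_sub, sub_mul,
    Finset.sum_sub_distrib]
  ring

theorem intAffine_add_smul {m : ℕ} (c : (Fin m → ℤ) × ℤ) (x u : Fin m → ℝ) (τ : ℝ) :
    intAffine c (x + τ • u) = intAffine c x + τ * ∑ i, c.1 i * u i := by
  simp only [intAffine, Pi.add_apply, Pi.smul_apply, smul_eq_mul, mul_add, Finset.sum_add_distrib,
    Finset.mul_sum, add_assoc]
  congr 3
  ext i
  ring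

/-- Generic points of a hyperplane `x j = c`: an affine function that does not vanish identically
on it is nonzero at the projections of a dense set of points. -/
theorem dense_intAffine_update_ne_zero {m : ℕ} {j : Fin m} {c : ℝ} (d : (Fin m → ℤ) × ℤ)
    (hd : ∃ y, y j = c ∧ intAffine d y ≠ 0) :
    Dense {x : Fin m → ℝ | intAffine d (Function.update x j c) ≠ 0} := by
  obtain ⟨y, hy, hdy⟩ := hd
  intro x
  by_cases hx : intAffine d (Function.update x j c) = 0
  swap
  · exact subset_closure hx
  have hlim : Filter.Tendsto (fun τ : ℝ => x + τ • (y - x)) (nhdsWithin 0 (Set.Ioi 0))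
      (nhds x) := by
    have : Continuous (fun τ : ℝ => x + τ • (y - x)) := by fun_prop
    simpa using (this.tendsto 0).mono_left nhdsWithin_le_nhds
  refine mem_closure_of_tendsto hlim ?_
  filter_upwards [self_mem_nhdsWithin] with τ hτ
  have hupd : Function.update (x + τ • (y - x)) j c =
      Function.update x j c + τ • (y - Function.update x j c) := by
    ext i
    by_cases hi : i = j
    · subst hi
      simp [hy]
    · simp [hi]
  have h1 := intAffine_add_smul d (Function.update x j c) (y - Function.update x j c) 1
  have h2 := intAffine_add_smul d (Function.update x j c) (y - Function.update x j c) τ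
  rw [← hupd, hx] at h2
  rw [hx] at h1
  simp only [one_smul, add_sub_cancel] at h1
  change intAffine d (Function.update (x + τ • (y - x)) j c) ≠ 0
  rw [h2, zero_add]
  refine mul_ne_zero (ne_of_gt hτ) fun h0 => hdy ?_
  rw [h1, h0]
  simp

theorem exists_common_denominator {m : ℕ} (r : Fin m → ℚ) :
    ∃ (q : ℕ) (P : Fin m → ℤ), 0 < q ∧ ∀ i, r i = P i / q := by
  have hdvd (i : Fin m) : (r i).den ∣ ∏ i, (r i).den := Finset.dvd_prod_of_mem _ (Finset.mem_univ i)
  choose e he using hdvd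
  have hpos : 0 < ∏ i, (r i).den := Finset.prod_pos fun i _ => (r i).pos
  refine ⟨∏ i, (r i).den, fun i => (r i).num * e i, hpos, fun i => ?_⟩
  have h0 : ((∏ i, (r i).den : ℕ) : ℚ) ≠ 0 := by exact_mod_cast hpos.ne'
  rw [eq_div_iff h0, he i]
  push_cast
  rw [← mul_assoc, Rat.mul_den_eq_num]

/-- If finitely many affine functions are pairwise equal or nowhere equal on a preconnected set,
a continuous function agreeing pointwise with one of them agrees with a single one throughout. -/
theorem eqOn_intAffine_of_isPreconnected {m : ℕ} {f : (Fin m → ℝ) → ℝ} (hf : Continuous f)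
    {S : Set ((Fin m → ℤ) × ℤ)} (hS : S.Finite) (hfS : ∀ x, ∃ c ∈ S, f x = intAffine c x)
    {U : Set (Fin m → ℝ)} (hU : IsPreconnected U) (hne : U.Nonempty)
    (hdich : ∀ c ∈ S, ∀ d ∈ S, (∀ x ∈ U, intAffine c x = intAffine d x) ∨
      ∀ x ∈ U, intAffine c x ≠ intAffine d x) :
    ∃ c ∈ S, ∀ x ∈ U, f x = intAffine c x := by
  obtain ⟨x₀, hx₀⟩ := hne
  obtain ⟨c, hc, hcx⟩ := hfS x₀
  refine ⟨c, hc, fun x hx => ?_⟩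
  by_contra hxc
  have hclosed (d : (Fin m → ℤ) × ℤ) : IsClosed {y | f y = intAffine d y} :=
    isClosed_eq hf (continuous_intAffine d)
  let S' := {d ∈ S | ∀ y ∈ U, intAffine d y ≠ intAffine c y}
  have hS' : S'.Finite := hS.subset (Set.sep_subset _ _)
  have hcover (y : Fin m → ℝ) (hy : y ∈ U) (hyc : f y ≠ intAffine c y) :
      y ∈ ⋃ d ∈ S', {y | f y = intAffine d y} := by
    obtain ⟨d, hd, hdy⟩ := hfS y
    refine Set.mem_biUnion (x := d) ⟨hd, (hdich d hd c hc).resolve_left fun h => ?_⟩ hdy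
    exact hyc (hdy.trans (h y hy))
  obtain ⟨y, hy, hyc, hyd⟩ := isPreconnected_closed_iff.1 hU _ _ (hclosed c)
    (hS'.isClosed_biUnion fun d _ => hclosed d)
    (fun y hy => (em (f y = intAffine c y)).imp id (hcover y hy))
    ⟨x₀, hx₀, hcx⟩ ⟨x, hx, hcover x hx hxc⟩
  obtain ⟨d, hd, hdy⟩ := Set.mem_iUnion₂.1 hyd
  exact hd.2 y hy (Eq.trans (Eq.symm hdy) hyc)

/-- A `ℤ`-function that is not constant on a facet `x j = c` of the cube coincides, near a suitable
rational point `P / q` of that facet, with one affine function that is not constant along the facet.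
The sign `s` is that of the inward normal. -/
theorem exists_affine_near_facet {m : ℕ} {f : (Fin m → ℝ) → ℝ} (hf : IsZFun f) {j : Fin m}
    {c : ℝ} {s : ℤ} (hcs : c = 0 ∧ s = 1 ∨ c = 1 ∧ s = -1) {v w : Fin m → ℝ}
    (hv : v ∈ unitCube m) (hw : w ∈ unitCube m) (hvj : v j = c) (hwj : w j = c)
    (hvw : f v ≠ f w) :
    ∃ (q : ℕ) (P : Fin m → ℤ) (ε : ℝ) (a : (Fin m → ℤ) × ℤ) (l : Fin m), 0 < q ∧ 0 < ε ∧ l ≠ j ∧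
      a.1 l ≠ 0 ∧ (P j : ℝ) / q = c ∧ ∀ x : Fin m → ℝ, (∀ i, |x i - P i / q| < ε) →
        0 ≤ s * (x j - c) → x ∈ unitCube m ∧ f x = intAffine a x := by
  obtain ⟨hfc, S, hS, hfS⟩ := hf
  let Z : Set ℝ := (fun e => intAffine e v) '' S
  have hZ : Z.Finite := hS.image _
  let H : Set ((Fin m → ℤ) × ℤ) :=
    {d ∈ Set.image2 (· - ·) S S | ∃ y, y j = c ∧ intAffine d y ≠ 0}
  have hH : H.Finite := (hS.image2 _ hS).subset (Set.sep_subset _ _)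
  have hupd : Continuous (fun x : Fin m → ℝ => Function.update x j c) :=
    continuous_id.update j continuous_const
  -- By the intermediate value theorem the facet contains a point where `f` differs from the values
  -- of all pieces that are constant along the facet.
  obtain ⟨y, hy, hyj, hyZ⟩ : ∃ y ∈ unitCube m, y j = c ∧ f y ∉ Z := by
    have hinf : (Set.uIcc (f v) (f w)).Infinite := Set.Icc_infinite (by simpa [eq_comm] using hvw)
    obtain ⟨b, hb, hbZ⟩ := hinf.exists_notMem_finite hZ
    have hγ : Continuous (fun τ : ℝ => f (v + τ • (w - v))) := hfc.comp (by fun_prop)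
    have hivt := intermediate_value_uIcc (a := 0) (b := 1) hγ.continuousOn
    simp only [zero_smul, add_zero, one_smul, add_sub_cancel] at hivt
    obtain ⟨τ, hτ, rfl⟩ := hivt hb
    rw [Set.uIcc_of_le zero_le_one] at hτ
    exact ⟨v + τ • (w - v), (convex_unitCube m).add_smul_sub_mem hv hw hτ, by simp [hvj, hwj], hbZ⟩
  -- Nearby, a rational point avoids all walls between pieces that do not contain the facet.
  obtain ⟨r, hr01, hrZ, hrH⟩ : ∃ r : Fin m → ℚ, (∀ i, 0 < (r i : ℝ) ∧ (r i : ℝ) < 1) ∧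
      f (Function.update (fun i => (r i : ℝ)) j c) ∉ Z ∧
      ∀ d ∈ H, intAffine d (Function.update (fun i => (r i : ℝ)) j c) ≠ 0 := by
    have hopen1 : IsOpen {x | f (Function.update x j c) ∉ Z} :=
      hZ.isClosed.isOpen_compl.preimage (hfc.comp hupd)
    have hopen2 : IsOpen (Set.pi Set.univ fun _ : Fin m => Set.Ioo (0 : ℝ) 1) :=
      isOpen_set_pi Set.finite_univ fun _ _ => isOpen_Ioo
    have hne : ({x | f (Function.update x j c) ∉ Z} ∩
        Set.pi Set.univ fun _ : Fin m => Set.Ioo (0 : ℝ) 1).Nonempty := by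
      have hycl : y ∈ closure (Set.pi Set.univ fun _ : Fin m => Set.Ioo (0 : ℝ) 1) := by
        rw [closure_pi_set]
        simpa only [closure_Ioo zero_ne_one, unitCube_eq_pi] using hy
      refine mem_closure_iff.1 hycl _ hopen1 ?_
      change f (Function.update y j c) ∉ Z
      rwa [← hyj, Function.update_eq_self]
    have hopen3 (d) : IsOpen {x : Fin m → ℝ | intAffine d (Function.update x j c) ≠ 0} :=
      isOpen_ne_fun ((continuous_intAffine d).comp hupd) continuous_const
    have hdense : Dense (⋂ d ∈ H, {x : Fin m → ℝ | intAffine d (Function.update x j c) ≠ 0}) :=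
      dense_biInter_of_isOpen (fun d _ => hopen3 d) hH.countable
        fun d hd => dense_intAffine_update_ne_zero d hd.2
    have hrat : DenseRange (Pi.map fun (_ : Fin m) (x : ℚ) => (x : ℝ)) :=
      DenseRange.piMap fun _ => Rat.denseRange_cast
    obtain ⟨r, ⟨h1, h2⟩, h3⟩ := hrat.exists_mem_open
      ((hopen1.inter hopen2).inter (hH.isOpen_biInter fun d _ => hopen3 d))
      (hdense.inter_open_nonempty _ (hopen1.inter hopen2) hne)
    refine ⟨r, fun i => h2 i trivial, h1, fun d hd => ?_⟩
    exact Set.mem_iInter₂.1 h3 d hd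
  obtain ⟨q, P, hq, hP⟩ := exists_common_denominator
    (Function.update r j (if c = 0 then 0 else 1))
  have hp : (fun i => (P i : ℝ) / q) = Function.update (fun i => (r i : ℝ)) j c := by
    ext i
    have : ((P i : ℝ) / q) = ((P i / q : ℚ) : ℝ) := by push_cast; rfl
    rw [this, ← hP]
    by_cases hi : i = j
    · subst hi
      rcases hcs with ⟨rfl, -⟩ | ⟨rfl, -⟩ <;> simp
    · simp [hi]
  rw [← hp] at hrZ hrH
  have hpj : (P j : ℝ) / q = c := by simpa using congrFun hp j
  have hpi (i : Fin m) (hi : i ≠ j) : 0 < (P i : ℝ) / q ∧ (P i : ℝ) / q < 1 := by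
    have := congrFun hp i
    simp only [Function.update_of_ne hi] at this
    rw [this]
    exact hr01 i
  set p : Fin m → ℝ := fun i => (P i : ℝ) / q with hp_def
  have hev : ∀ᶠ x in nhds p, (∀ i, i ≠ j → 0 < x i ∧ x i < 1) ∧ |x j - c| < 1 ∧
      ∀ d ∈ H, intAffine d x ≠ 0 := by
    refine Filter.Eventually.and ?_ (Filter.Eventually.and ?_ ?_)
    · refine Filter.eventually_all.2 fun i => ?_
      by_cases hi : i = j
      · simp [hi]
      · have hc : ContinuousAt (fun x : Fin m → ℝ => x i) p := (continuous_apply i).continuousAt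
        filter_upwards [hc.eventually_mem (Ioo_mem_nhds (hpi i hi).1 (hpi i hi).2)] with x hx _
        exact hx
    · refine (show Continuous fun x : Fin m → ℝ => |x j - c| by fun_prop).continuousAt.eventually_lt
        continuousAt_const ?_
      change |(P j : ℝ) / q - c| < 1
      simp [hpj]
    · refine (Filter.eventually_all_finite hH).2 fun d hd => ?_
      exact (continuous_intAffine d).continuousAt.eventually_ne (hrH d hd)
  obtain ⟨ε, hε, hball⟩ := Metric.eventually_nhds_iff_ball.1 hev
  have hs : (s : ℝ) * s = 1 := by rcases hcs with ⟨-, rfl⟩ | ⟨-, rfl⟩ <;> norm_num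
  let U : Set (Fin m → ℝ) := Metric.ball p ε ∩ {x | 0 < s * (x j - c)}
  have hUconv : Convex ℝ U := by
    refine (convex_ball p ε).inter fun x hx y hy a b ha hb hab => ?_
    simp only [Set.mem_ofPred_eq, Pi.add_apply, Pi.smul_apply, smul_eq_mul] at hx hy ⊢
    have : s * (a * x j + b * y j - c) = a * (s * (x j - c)) + b * (s * (y j - c)) := by
      linear_combination (s * c) * hab
    rw [this]
    rcases ha.eq_or_lt with rfl | ha
    · have : b = 1 := by linarith
      subst this
      linarith
    · have := mul_pos ha hx
      have := mul_nonneg hb hy.le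
      linarith
  -- Points of the half ball, its flat side included, are limits of points of its interior.
  have hcl : ∀ x ∈ Metric.ball p ε, 0 ≤ s * (x j - c) → x ∈ closure U := by
    intro x hx hxj
    have hcont : Continuous (fun τ : ℝ => x + τ • Pi.single (M := fun _ => ℝ) j (s : ℝ)) := by
      fun_prop
    have h0 := hcont.tendsto 0
    simp only [zero_smul, add_zero] at h0
    have hlim := h0.mono_left (nhdsWithin_le_nhds (s := Set.Ioi 0))
    refine mem_closure_of_tendsto hlim ?_
    filter_upwards [hlim.eventually_mem (Metric.isOpen_ball.mem_nhds hx), self_mem_nhdsWithin]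
      with τ h1 h2
    refine ⟨h1, ?_⟩
    simp only [Set.mem_ofPred_eq, Pi.add_apply, Pi.smul_apply, Pi.single_eq_same, smul_eq_mul]
    have : s * (x j + τ * s - c) = s * (x j - c) + τ := by linear_combination τ * hs
    rw [this]
    exact add_pos_of_nonneg_of_pos hxj h2
  have hpcl : p ∈ closure U := hcl p (Metric.mem_ball_self hε) (by simp [p, hpj])
  obtain ⟨a, ha, haU⟩ := eqOn_intAffine_of_isPreconnected hfc hS hfS hUconv.isPreconnected
    (closure_nonempty_iff.1 ⟨p, hpcl⟩) (by
      intro d hd e he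
      by_cases hde : d - e ∈ H
      · right
        intro x hx h
        exact (hball x hx.1).2.2 _ hde (by rw [intAffine_sub, h, sub_self])
      · -- The difference vanishes on the facet, so it is a multiple of `x j - c`.
        have hvan (x : Fin m → ℝ) :
            intAffine d x - intAffine e x = (d - e).1 j * (x j - c) := by
          have h0 : intAffine (d - e) (Function.update x j c) = 0 := by
            by_contra h
            exact hde ⟨⟨d, hd, e, he, rfl⟩, _, by simp, h⟩
          have hx : x = Function.update x j c + (x j - c) • Pi.single (M := fun _ => ℝ) j 1 := by
            ext i
            by_cases hi : i = j
            · subst hi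
              simp
            · simp [hi]
          rw [← intAffine_sub]
          conv_lhs => rw [hx]
          rw [intAffine_add_smul, h0]
          simp [Pi.single_apply, mul_comm]
        by_cases hz : (d - e).1 j = 0
        · left
          intro x _
          have := hvan x
          rw [hz] at this
          simpa [sub_eq_zero] using this
        · right
          intro x hx h
          have := hvan x
          rw [h, sub_self, eq_comm, mul_eq_zero] at this
          rcases this with h | h
          · exact hz (by exact_mod_cast h)
          · have := hx.2
            simp [h] at this)
  have haU' : ∀ x ∈ closure U, f x = intAffine a x := fun x hx =>
    closure_minimal (t := {x | f x = intAffine a x}) haU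
      (isClosed_eq hfc (continuous_intAffine a)) hx
  obtain ⟨l, hlj, hal⟩ : ∃ l, l ≠ j ∧ a.1 l ≠ 0 := by
    by_contra! hall
    refine hrZ ⟨a, ha, ?_⟩
    rw [haU' p hpcl]
    simp only [intAffine]
    congr 1
    refine Finset.sum_congr rfl fun i _ => ?_
    by_cases hi : i = j
    · subst hi
      simp [p, hpj, hvj]
    · simp [hall i hi]
  refine ⟨q, P, ε, a, l, hq, hε, hlj, hal, hpj, fun x hx hxj => ?_⟩
  have hxb : x ∈ Metric.ball p ε := by
    rw [Metric.mem_ball, dist_pi_lt_iff hε]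
    exact hx
  refine ⟨fun i => ?_, haU' x (hcl x hxb hxj)⟩
  by_cases hi : i = j
  · subst hi
    have := abs_lt.1 (hball x hxb).2.1
    rcases hcs with ⟨rfl, rfl⟩ | ⟨rfl, rfl⟩ <;> push_cast at hxj <;> constructor <;> linarith
  · exact ⟨((hball x hxb).1 i hi).1.le, ((hball x hxb).1 i hi).2.le⟩

/-! ### Pushing inwards along the fibres -/

/-- If a `ℤ`-function `f` is not constant on some facet of the cube, then a `ℤ`-map of the cube into
itself that moves points only along the fibres of `f` can avoid a rational point of the cube:
near a suitable boundary point, everything is pushed inwards in a direction tangent to the fibres.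
-/
theorem exists_push_avoiding {m : ℕ} {f : (Fin m → ℝ) → ℝ} (hf : IsZFun f) {j : Fin m}
    {c : ℝ} {s : ℤ} (hcs : c = 0 ∧ s = 1 ∨ c = 1 ∧ s = -1) {v w : Fin m → ℝ}
    (hv : v ∈ unitCube m) (hw : w ∈ unitCube m) (hvj : v j = c) (hwj : w j = c)
    (hvw : f v ≠ f w) :
    ∃ α : (Fin m → ℝ) → Fin m → ℝ, IsGlobalZMap α ∧
      (∀ x ∈ unitCube m, α x ∈ unitCube m ∧ f (α x) = f x) ∧
      ∃ (q : ℕ) (P : Fin m → ℤ), 0 < q ∧ (fun i => (P i : ℝ) / q) ∈ unitCube m ∧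
        ∀ x ∈ unitCube m, α x ≠ fun i => (P i : ℝ) / q := by
  obtain ⟨q, P, ε, a, l, hq, hε, hlj, hal, hpj, hR⟩ :=
    exists_affine_near_facet hf hcs hv hw hvj hwj hvw
  have hs : (s : ℝ) * s = 1 := by rcases hcs with ⟨-, rfl⟩ | ⟨-, rfl⟩ <;> norm_num
  have hside (x : Fin m → ℝ) (hx : x ∈ unitCube m) : 0 ≤ s * (x j - c) := by
    have := hx j
    rcases hcs with ⟨rfl, rfl⟩ | ⟨rfl, rfl⟩ <;> push_cast <;> linarith
  -- An inward direction along which the affine function `a` is constant.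
  obtain ⟨u, hu_def⟩ : ∃ u : Fin m → ℤ,
      u = Pi.single j (s * a.1 l ^ 2) + Pi.single l (-(s * a.1 j * a.1 l)) := ⟨_, rfl⟩
  have huj : u j = s * a.1 l ^ 2 := by simp [hu_def, hlj.symm]
  have hau : ∑ i, (a.1 i : ℝ) * (u i : ℝ) = 0 := by
    have : ∑ i, a.1 i * u i = 0 := by
      simp only [hu_def, Pi.add_apply, mul_add, Finset.sum_add_distrib, Pi.single_apply,
        mul_ite, mul_zero, Finset.sum_ite_eq', Finset.mem_univ, if_true]
      ring
    exact_mod_cast this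
  have hq0 : (0 : ℝ) < q := by exact_mod_cast hq
  obtain ⟨D, hD1, hD⟩ : ∃ D : ℝ, 1 ≤ D ∧ ∀ i, |(u i : ℝ)| ≤ D := by
    refine ⟨1 + ∑ i, |(u i : ℝ)|, ?_, fun i => ?_⟩
    · linarith [Finset.sum_nonneg fun i (_ : i ∈ Finset.univ) => abs_nonneg (u i : ℝ)]
    · linarith [Finset.single_le_sum (f := fun i => |(u i : ℝ)|) (fun i _ => abs_nonneg _)
        (Finset.mem_univ i)]
  obtain ⟨K, hK⟩ := exists_nat_gt (2 * D / ε)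
  have hK0 : (0 : ℝ) < K := lt_trans (by positivity) hK
  have hKε : 2 * D < K * ε := by rwa [div_lt_iff₀ hε] at hK
  -- The size of the displacement: it is at most `1 / K`, and positive at some points of the facet.
  let φ : (Fin m → ℝ) → ℝ := fun x => min (bump K q P x) |q * x l - P l|
  have hφZ : IsZFun φ := by
    refine (isZFun_bump K q P).min ?_
    simpa using (((IsZFun.coord l).int_mul (q : ℤ)).sub (IsZFun.const (P l))).abs
  have hφ0 (x) : 0 ≤ φ x := le_min (bump_nonneg K q P x) (abs_nonneg _)
  have hφsmall (x) (hx : 0 < φ x) : K * φ x < 1 ∧ ∀ i, |x i - P i / q| < ε / 2 := by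
    have hb : 0 < bump K q P x := hx.trans_le (min_le_left _ _)
    refine ⟨lt_of_le_of_lt (mul_le_mul_of_nonneg_left (min_le_right _ _) hK0.le)
      (mul_abs_lt_one_of_bump_pos hb l), fun i => ?_⟩
    have h1 := mul_abs_lt_one_of_bump_pos hb i
    have h2 := mul_le_mul_of_nonneg_left (abs_sub_div_le hq (x i) (P i)) hK0.le
    have h3 : K * |x i - P i / q| < K * (ε / 2) := by linarith
    exact lt_of_mul_lt_mul_left h3 hK0.le
  let α : (Fin m → ℝ) → Fin m → ℝ := fun x => x + φ x • fun i => (u i : ℝ)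
  have hαj (x) : s * (α x j - c) = s * (x j - c) + φ x * a.1 l ^ 2 := by
    simp only [α, Pi.add_apply, Pi.smul_apply, smul_eq_mul, huj]
    push_cast
    linear_combination φ x * a.1 l ^ 2 * hs
  have hmove (x) (hx : x ∈ unitCube m) (hpos : 0 < φ x) :
      (∀ i, |α x i - P i / q| < ε) ∧ 0 ≤ s * (α x j - c) := by
    obtain ⟨h1, h2⟩ := hφsmall x hpos
    refine ⟨fun i => ?_, ?_⟩
    · have h3 : |φ x * u i| < ε / 2 := by
        rw [abs_mul, abs_of_pos hpos]
        have h4 : φ x * |(u i : ℝ)| ≤ φ x * D := mul_le_mul_of_nonneg_left (hD i) hpos.le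
        have h5 : K * φ x * D < 1 * D := mul_lt_mul_of_pos_right h1 (by linarith)
        have h6 : K * (φ x * D) < K * (ε / 2) := by linarith
        exact h4.trans_lt (lt_of_mul_lt_mul_left h6 hK0.le)
      have h7 : α x i - P i / q = (x i - P i / q) + φ x * u i := by
        simp only [α, Pi.add_apply, Pi.smul_apply, smul_eq_mul]
        ring
      rw [h7]
      exact (abs_add_le _ _).trans_lt (by linarith [h2 i])
    · rw [hαj]
      exact add_nonneg (hside x hx) (mul_nonneg hpos.le (sq_nonneg _))
  -- The facet point `z` has positive displacement, so it is moved off the facet. Points enter the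
  -- facet from nowhere, and those staying in it are fixed, so `z` has no preimage under `α`.
  obtain ⟨z, hz⟩ : ∃ z : Fin m → ℝ, z = fun i =>
    ((2 * K * P i + if i = l then 1 else 0 : ℤ) : ℝ) / (2 * K * q : ℕ) := ⟨_, rfl⟩
  have hzi (i : Fin m) : z i = P i / q + if i = l then (1 / (2 * K * q) : ℝ) else 0 := by
    rw [hz]
    by_cases hi : i = l
    · simp only [hi, if_true]
      push_cast
      field_simp
    · simp only [hi, if_false]
      push_cast
      field_simp
      ring
  have hqz (i : Fin m) : q * z i - P i = if i = l then (1 / (2 * K) : ℝ) else 0 := by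
    rw [hzi]
    by_cases hi : i = l
    · simp only [hi, if_true]
      field_simp
      ring
    · simp only [hi, if_false]
      field_simp
      ring
  have hφz : 0 < φ z := by
    have hb : bump K q P z = 1 / 2 := by
      have : ∑ i, |q * z i - P i| = 1 / (2 * K) := by
        have hpos : (0 : ℝ) < 1 / (2 * K) := by positivity
        simp only [hqz, apply_ite abs, abs_zero, Finset.sum_ite_eq', Finset.mem_univ, if_true,
          abs_of_pos hpos]
      rw [bump, this]
      have : (K : ℝ) * (1 / (2 * K)) = 1 / 2 := by field_simp
      rw [this]
      norm_num
    refine lt_min (by rw [hb]; norm_num) ?_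
    rw [hqz, if_pos rfl]
    positivity
  have hzj : z j = c := by rw [hzi, if_neg hlj.symm, add_zero, hpj]
  refine ⟨α, isGlobalZMap_iff.2 fun i => ?_, fun x hx => ?_, 2 * K * q,
    fun i => 2 * K * P i + if i = l then 1 else 0, ?_, hz ▸ ?_, hz ▸ ?_⟩
  · convert (IsZFun.coord i).add (hφZ.int_mul (u i)) using 2
    simp [α, mul_comm]
  · rcases (hφ0 x).eq_or_lt with h | hpos
    · have : α x = x := by simp [α, ← h]
      rw [this]
      exact ⟨hx, rfl⟩
    · obtain ⟨h1, h2⟩ := hmove x hx hpos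
      obtain ⟨h3, h4⟩ := hR _ h1 h2
      refine ⟨h3, ?_⟩
      rw [h4, (hR x (fun i => ((hφsmall x hpos).2 i).trans (by linarith)) (hside x hx)).2]
      simp only [α]
      rw [intAffine_add_smul, hau, mul_zero, add_zero]
  · have : 0 < K := by exact_mod_cast hK0
    positivity
  · exact (hR z (fun i => ((hφsmall z hφz).2 i).trans (by linarith)) (by simp [hzj])).1
  · intro x hx hxz
    have h1 := hαj x
    rw [hxz, hzj, sub_self, mul_zero] at h1
    have hl : (0 : ℝ) < a.1 l ^ 2 := by positivity
    have h2 : φ x = 0 := by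
      refine le_antisymm ?_ (hφ0 x)
      by_contra hpos
      have := mul_pos (not_le.1 hpos) hl
      linarith [hside x hx]
    have h3 : α x = x := by simp [α, h2]
    rw [← hxz, h3, h2] at hφz
    exact lt_irrefl _ hφz

/-- In dimension at least two, a function that is not constant on the vertices of the cube is not
constant on the vertices of some facet. -/
theorem exists_facet_ne {m : ℕ} (hm : 2 ≤ m) (f : (Fin m → ℝ) → ℝ) {v w : Fin m → ℝ}
    (hv : v ∈ cubeVertices m) (hw : w ∈ cubeVertices m) (hvw : f v ≠ f w) :
    ∃ (j : Fin m) (v' w' : Fin m → ℝ), v' ∈ cubeVertices m ∧ w' ∈ cubeVertices m ∧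
      v' j = w' j ∧ f v' ≠ f w' := by
  obtain ⟨j, hj⟩ : ∃ j : Fin m, j = ⟨0, by omega⟩ := ⟨_, rfl⟩
  obtain ⟨k, hk⟩ : ∃ k : Fin m, k = ⟨1, by omega⟩ := ⟨_, rfl⟩
  have hkj : k ≠ j := by simp [hj, hk]
  have hu : Function.update w j (v j) ∈ cubeVertices m := by
    intro i
    by_cases hi : i = j
    · subst hi
      simpa using hv i
    · simpa [hi] using hw i
  by_cases h : f v = f (Function.update w j (v j))
  · exact ⟨k, _, w, hu, hw, by simp [hkj], h ▸ hvw⟩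
  · exact ⟨j, v, _, hv, hu, by simp, h⟩

/-! ### Strictly more general maps -/

theorem MoreGeneral.trans {d p q r : ℕ} {B : Set (Fin d → ℝ)} {ρ : unitCube p → B}
    {σ : unitCube q → B} {τ : unitCube r → B} (h : MoreGeneral ρ σ) (h' : MoreGeneral σ τ) :
    MoreGeneral ρ τ := by
  obtain ⟨α, ⟨g, hg, hαg⟩, rfl⟩ := h
  obtain ⟨β, ⟨k, hk, hβk⟩, rfl⟩ := h'
  refine ⟨α ∘ β, ⟨fun x => g (k x), isGlobalZMap_iff.2 fun j =>
    (isGlobalZMap_iff.1 hg j).comp (isGlobalZMap_iff.1 hk), fun x => ?_⟩, rfl⟩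
  rw [Function.comp_apply, hαg, hβk]

/-- In dimension at least two, every `ℤ`-map to the boundary of the square that is not constant on
the vertices of the cube has a strictly more general one with the same domain. -/
theorem exists_strictlyMoreGeneral {m : ℕ} (hm : 2 ≤ m) {θ : unitCube m → squareBoundary}
    (hθ : IsZMap θ) {v w : unitCube m} (hv : (v : Fin m → ℝ) ∈ cubeVertices m)
    (hw : (w : Fin m → ℝ) ∈ cubeVertices m) (hvw : θ v ≠ θ w) :
    ∃ ψ : unitCube m → squareBoundary, IsZMap ψ ∧ StrictlyMoreGeneral ψ θ := by
  obtain ⟨t, ht, ⟨M, hM⟩, hθt⟩ := exists_lift hθ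
  have htvw : t v ≠ t w := fun h => hvw (Subtype.ext (by rw [hθt, hθt, h]))
  obtain ⟨j, v', w', hv', hw', hj, hne⟩ := exists_facet_ne hm t hv hw htvw
  obtain ⟨c, s, hcs, hvc⟩ : ∃ (c : ℝ) (s : ℤ), (c = 0 ∧ s = 1 ∨ c = 1 ∧ s = -1) ∧ v' j = c := by
    rcases hv' j with h | h
    · exact ⟨0, 1, Or.inl ⟨rfl, rfl⟩, h⟩
    · exact ⟨1, -1, Or.inr ⟨rfl, rfl⟩, h⟩
  obtain ⟨α, hα, hαt, q, P, hq, hz, hαz⟩ := exists_push_avoiding ht hcs (cubeVertices_subset m hv')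
    (cubeVertices_subset m hw') hvc (hj ▸ hvc) hne
  obtain ⟨K, hK⟩ := exists_bump_eq_zero hq
    ((isCompact_unitCube m).image hα.1).isClosed (P := P) (by
      rintro ⟨x, hx, h⟩
      exact hαz x hx h)
  -- The bump at the avoided point is so high that the lift oscillates more than `t` does.
  obtain ⟨L, hL⟩ := exists_nat_gt (4 * M)
  have hchi : IsZFun fun x => ((L : ℤ) : ℝ) * bump K q P x := (isZFun_bump K q P).int_mul L
  have hψ := ht.add hchi
  have hb1 (x) : bump K q P x ≤ 1 :=
    max_le zero_le_one (sub_le_self _ (mul_nonneg (Nat.cast_nonneg K)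
      (Finset.sum_nonneg fun _ _ => abs_nonneg _)))
  have hψM (x) : |t x + ((L : ℤ) : ℝ) * bump K q P x| ≤ M + L := by
    refine (abs_add_le _ _).trans (add_le_add (hM x) ?_)
    rw [abs_of_nonneg (mul_nonneg (by positivity) (bump_nonneg K q P x)), Int.cast_natCast]
    exact mul_le_of_le_one_right (Nat.cast_nonneg L) (hb1 x)
  let ψ : unitCube m → squareBoundary := fun x =>
    ⟨squareParam ((t x + ((L : ℤ) : ℝ) * bump K q P x : ℝ)), squareParam_mem _⟩
  refine ⟨ψ, ⟨_, hψ.isGlobalZMap_squareParam hψM, fun x => rfl⟩,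
    ⟨fun x => ⟨α x, (hαt x x.2).1⟩, ⟨α, hα, fun x => rfl⟩, ?_⟩, ?_⟩
  · ext1 x
    refine Subtype.ext ?_
    simp only [Function.comp_apply, ψ]
    rw [hθt, hK _ ⟨x, x.2, rfl⟩, (hαt x x.2).2, mul_zero, add_zero]
  · rintro ⟨β, ⟨g, hg, hβg⟩, hβ⟩
    -- Both sides lift the same map, so they differ by a fixed number of turns on the cube.
    have hturn (x : Fin m → ℝ) (hx : x ∈ unitCube m) :
        ∃ k : ℤ, t (g x) - (t x + ((L : ℤ) : ℝ) * bump K q P x) = 4 * k := by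
      refine exists_sub_eq_of_squareParam_eq ?_
      have h := congrArg Subtype.val (congrFun hβ ⟨x, hx⟩)
      simpa [ψ, hθt, hβg] using h
    have hconst : ∀ x ∈ unitCube m, ∀ y ∈ unitCube m,
        t (g x) - (t x + ((L : ℤ) : ℝ) * bump K q P x) =
          t (g y) - (t y + ((L : ℤ) : ℝ) * bump K q P y) := by
      intro x hx y hy
      refine (convex_unitCube m).isPreconnected.constant_of_mapsTo
        (f := fun x => t (g x) - (t x + ((L : ℤ) : ℝ) * bump K q P x))
        (T := (AddSubgroup.zmultiples (4 : ℝ) : Set ℝ)) ?_ ?_ ?_ hx hy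
      · exact isDiscrete_iff_discreteTopology.2
          (inferInstanceAs (DiscreteTopology (AddSubgroup.zmultiples (4 : ℝ))))
      · exact ((ht.1.comp hg.1).sub hψ.1).continuousOn
      · intro x hx
        obtain ⟨k, hk⟩ := hturn x hx
        exact AddSubgroup.mem_zmultiples_iff.2 ⟨k, Eq.trans (by rw [zsmul_eq_mul, mul_comm]) hk.symm⟩
    have h0 := cubeVertices_subset m hv'
    have h1 := hconst _ hz _ (hαt _ h0).1
    rw [bump_center K hq, hK _ ⟨_, h0, rfl⟩] at h1
    have hLM : (4 : ℝ) * M < ((L : ℤ) : ℝ) := by simpa using hL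
    have b1 := abs_le.1 (hM (g fun i => (P i : ℝ) / q))
    have b2 := abs_le.1 (hM fun i => (P i : ℝ) / q)
    have b3 := abs_le.1 (hM (g (α v')))
    have b4 := abs_le.1 (hM (α v'))
    linarith

theorem lemmal (n : ℕ) (η : unitCube n → squareBoundary) (hη : IsZMap η)
    (hne : ¬ ∃ c : squareBoundary, ∀ x : unitCube n, (x : Fin n → ℝ) ∈ cubeVertices n → η x = c)
    (n' : ℕ) (θ : unitCube n' → squareBoundary) (hθ : IsZMap θ) (hθη : MoreGeneral θ η) :
    ∃ ψ : unitCube (max 2 n') → squareBoundary, IsZMap ψ ∧ StrictlyMoreGeneral ψ θ := by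
  obtain ⟨α, hα, rfl⟩ := hθη
  have hn : n' ≤ max 2 n' := le_max_right _ _
  -- Up to equivalence, `θ` may be regarded as defined on the cube of dimension `max 2 n'`.
  let pr : unitCube (max 2 n') → unitCube n' := fun x =>
    ⟨fun i => (x : Fin (max 2 n') → ℝ) (Fin.castLE hn i), fun i => x.2 _⟩
  let pad : (Fin n' → ℝ) → Fin (max 2 n') → ℝ := fun x i => if h : i < n' then x ⟨i, h⟩ else 0
  let inc : unitCube n' → unitCube (max 2 n') := fun x => ⟨pad x, fun i => by
    by_cases h : (i : ℕ) < n'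
    · simpa [pad, h] using x.2 _
    · simp [pad, h]⟩
  have hpr : IsGlobalZMap fun (x : Fin (max 2 n') → ℝ) (i : Fin n') => x (Fin.castLE hn i) :=
    isGlobalZMap_iff.2 fun i => IsZFun.coord _
  have hpad : IsGlobalZMap pad := isGlobalZMap_iff.2 fun i => by
    by_cases h : (i : ℕ) < n'
    · simpa [pad, h] using IsZFun.coord _
    · simpa [pad, h] using IsZFun.const 0
  have hinc : IsZMap inc := ⟨pad, hpad, fun _ => rfl⟩
  have hprinc (x) : pr (inc x) = x := Subtype.ext (by ext i; simp [pr, inc, pad])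
  have hθ' : IsZMap (θ ∘ pr) := by
    obtain ⟨g, hg, h⟩ := hθ
    exact ⟨fun x => g fun i => x (Fin.castLE hn i), isGlobalZMap_iff.2 fun j =>
      (isGlobalZMap_iff.1 hg j).comp (isGlobalZMap_iff.1 hpr), fun x => h (pr x)⟩
  have hθpr : MoreGeneral θ (θ ∘ pr) := ⟨pr, ⟨_, hpr, fun _ => rfl⟩, rfl⟩
  have hprθ : MoreGeneral (θ ∘ pr) θ := ⟨inc, hinc, funext fun x => congrArg θ (hprinc x)⟩
  have h0 : (fun _ : Fin n => (0 : ℝ)) ∈ cubeVertices n := fun _ => Or.inl rfl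
  let o : unitCube n := ⟨_, cubeVertices_subset n h0⟩
  obtain ⟨x, hx, hxo⟩ : ∃ x : unitCube n, (x : Fin n → ℝ) ∈ cubeVertices n ∧
      θ (α x) ≠ θ (α o) := by
    by_contra! h
    exact hne ⟨θ (α o), h⟩
  obtain ⟨ψ, hψ, h1, h2⟩ := exists_strictlyMoreGeneral (le_max_left 2 n') hθ'
    (hinc.map_cubeVertices (hα.map_cubeVertices hx))
    (hinc.map_cubeVertices (hα.map_cubeVertices (x := o) h0))
    (by simpa [hprinc] using hxo)
  exact ⟨ψ, hψ, h1.trans hprθ, fun h => h2 (hprθ.trans h)⟩
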